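/- Let $d,r\ge 1$, let $M_d$ be the algebra of complex $d\times d$ matrices and let $\Phi:M_d\to M_d$ be a linear map. A linear map $\Lambda:M_d\to M_d$ is called $r$-positive if $\mathrm{id}_r\otimes\Lambda$ maps positive semidefinite elements of $M_r\otimes M_d$ to positive semidefinite ones, and completely positive if it is $k$-positive for every $k$. The Schmidt rank $\mathrm{SR}(\psi)$ of a vector $\psi\in\mathbb C^d\otimes\mathbb C^d$ is the number of its non-vanishing Schmidt coefficients, and the Schmidt number of a density matrix $\sigma$ on $\mathbb C^d\otimes\mathbb C^d$ is $\mathrm{SN}(\sigma)=\min\max_k \mathrm{SR}(\psi_k)$, the minimum being over all finite decompositions $\sigma=\sum_k p_k|\psi_k\rangle\langle\psi_k|$ with $p_k\ge 0$, $\sum_k p_k=1$, $\|\psi_k\|=1$. The map $\Phi$ is called $r$-CPT if it is completely positive and trace preserving and $\mathrm{SN}(\Phi):=\mathrm{SN}\big((\mathrm{id}_d\otimes\Phi)P_d^+\big)\le r$, where $P_d^+$ is the orthogonal projector onto the maximally entangled vector $d^{-1/2}\sum_k e_k\otimes e_k$, with $e_1,\dots,e_d$ the standard basis of $\mathbb C^d$.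 **Theorem 2.** (i) $\Phi$ is $r$-CPT if and only if $\Phi$ is trace preserving and $\Lambda\circ\Phi$ is completely positive for every $r$-positive map $\Lambda:M_d\to M_d$. (ii) $\Phi$ is $r$-CPT if and only if $\Phi$ is trace preserving and $\Phi\circ\Lambda$ is completely positive for every $r$-positive map $\Lambda:M_d\to M_d$. -/

import Mathlib

open scoped Kronecker ComplexOrder

noncomputable section

namespace SchmidtCPT

/-- The algebra `M_d` of complex `d × d` matrices. -/
abbrev Mat (d : ℕ) : Type := Matrix (Fin d) (Fin d) ℂ

/-- The algebra `M_k ⊗ M_d`, realised as matrices indexed by pairs. -/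
abbrev BiMat (k d : ℕ) : Type := Matrix (Fin k × Fin d) (Fin k × Fin d) ℂ

/-- The map `id_k ⊗ Λ : M_k ⊗ M_d → M_k ⊗ M_d`: it applies `Λ` to each of the `k × k` blocks,
every block being an element of `M_d`. -/
def idTensor (k : ℕ) {d : ℕ} (Λ : Mat d →ₗ[ℂ] Mat d) : BiMat k d →ₗ[ℂ] BiMat k d where
  toFun X := Matrix.of fun p q => Λ (Matrix.of fun a b => X (p.1, a) (q.1, b)) p.2 q.2
  map_add' X Y := by
    ext p q
    exact congrFun (congrFun (map_add Λ (Matrix.of fun a b => X (p.1, a) (q.1, b))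
      (Matrix.of fun a b => Y (p.1, a) (q.1, b))) p.2) q.2
  map_smul' c X := by
    ext p q
    exact congrFun (congrFun (map_smul Λ c (Matrix.of fun a b => X (p.1, a) (q.1, b))) p.2) q.2

/-- `id_k ⊗ Λ` is determined by its values on elementary tensors: `A ⊗ B ↦ A ⊗ Λ B`. -/
theorem idTensor_kronecker (k : ℕ) {d : ℕ} (Λ : Mat d →ₗ[ℂ] Mat d) (A : Mat k) (B : Mat d) :
    idTensor k Λ (A ⊗ₖ B) = A ⊗ₖ Λ B := by
  ext p q
  have h : (Matrix.of fun a b => (A ⊗ₖ B) (p.1, a) (q.1, b) : Mat d) = A p.1 q.1 • B := rfl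
  change Λ (Matrix.of fun a b => (A ⊗ₖ B) (p.1, a) (q.1, b)) p.2 q.2 = _
  rw [h, map_smul]
  rfl

/-- `Λ` is `k`-positive: `id_k ⊗ Λ` maps positive semidefinite elements of `M_k ⊗ M_d` to
positive semidefinite ones. -/
def IsKPositive (k : ℕ) {d : ℕ} (Λ : Mat d →ₗ[ℂ] Mat d) : Prop :=
  ∀ X : BiMat k d, X.PosSemidef → (idTensor k Λ X).PosSemidef

/-- `Λ` is completely positive: it is `k`-positive for every `k`. -/
def IsCP {d : ℕ} (Λ : Mat d →ₗ[ℂ] Mat d) : Prop :=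
  ∀ k : ℕ, IsKPositive k Λ

/-- `Λ` is trace preserving. -/
def IsTP {d : ℕ} (Λ : Mat d →ₗ[ℂ] Mat d) : Prop :=
  ∀ X : Mat d, (Λ X).trace = X.trace

/-- `Λ` is completely positive and trace preserving (a quantum channel). -/
def IsCPT {d : ℕ} (Λ : Mat d →ₗ[ℂ] Mat d) : Prop :=
  IsCP Λ ∧ IsTP Λ

/-- `|ψ⟩⟨ψ|` for a vector `ψ` of `ℂ^d ⊗ ℂ^d`, given by its coordinates in the basis
`e_i ⊗ e_j`. -/
def ketBra {d : ℕ} (ψ : Fin d × Fin d → ℂ) : BiMat d d :=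
  Matrix.vecMulVec ψ (star ψ)

/-- The Schmidt coefficients of `ψ = ∑ x_ij e_i ⊗ e_j`: the singular values of the operator on
the Hilbert space `ℂ^d` with matrix `(x_ij)`, in decreasing order and padded by zeros. -/
def schmidtCoeff {d : ℕ} (ψ : Fin d × Fin d → ℂ) : ℕ →₀ ℝ :=
  (Matrix.toEuclideanLin (Matrix.of fun i j => ψ (i, j))).singularValues

/-- The Schmidt rank of `ψ`: the number of non-vanishing Schmidt coefficients. -/
def schmidtRank {d : ℕ} (ψ : Fin d × Fin d → ℂ) : ℕ :=
  (schmidtCoeff ψ).support.card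

/-- `σ = ∑_k p_k |ψ_k⟩⟨ψ_k|` is a finite convex combination of projectors on unit vectors. -/
structure IsPureDecomposition {d : ℕ} (σ : BiMat d d) {m : ℕ} (p : Fin m → ℝ)
    (ψ : Fin m → Fin d × Fin d → ℂ) : Prop where
  nonneg : ∀ k, 0 ≤ p k
  sum_eq_one : ∑ k, p k = 1
  normalized : ∀ k, ∑ x, ‖ψ k x‖ ^ 2 = 1
  eq_sum : σ = ∑ k, (p k : ℂ) • ketBra (ψ k)

/-- The Schmidt number of `σ`: the minimum, over all decompositions of `σ` into pure states, of
the maximal Schmidt rank that occurs. (It is `⊤` if `σ` is not a density matrix, since then there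
is no decomposition.) -/
def schmidtNumber {d : ℕ} (σ : BiMat d d) : ℕ∞ :=
  sInf {n : ℕ∞ | ∃ (m : ℕ) (p : Fin m → ℝ) (ψ : Fin m → Fin d × Fin d → ℂ),
    IsPureDecomposition σ p ψ ∧
      n = ((Finset.univ.sup fun k => schmidtRank (ψ k) : ℕ) : ℕ∞)}

/-- The maximally entangled vector `d^(-1/2) ∑_k e_k ⊗ e_k`. -/
def maxEntangled (d : ℕ) : Fin d × Fin d → ℂ :=
  ((Real.sqrt d)⁻¹ : ℂ) • ∑ k : Fin d, Pi.single (k, k) 1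

/-- The state `(id_d ⊗ Φ) P⁺` dual to `Φ`, where `P⁺` is the projector on the maximally
entangled vector. -/
def dualState {d : ℕ} (Φ : Mat d →ₗ[ℂ] Mat d) : BiMat d d :=
  idTensor d Φ (ketBra (maxEntangled d))

/-- The Schmidt number of a map: that of its dual state. -/
def mapSchmidtNumber {d : ℕ} (Φ : Mat d →ₗ[ℂ] Mat d) : ℕ∞ :=
  schmidtNumber (dualState Φ)

/-- `Φ` is `r`-CPT: completely positive, trace preserving and of Schmidt number at most `r`. -/
def IsRCPT (r : ℕ) {d : ℕ} (Φ : Mat d →ₗ[ℂ] Mat d) : Prop :=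
  IsCPT Φ ∧ mapSchmidtNumber Φ ≤ r

end SchmidtCPT

end

/-! A pure-state decomposition of the dual state is a Kraus decomposition of `Φ` whose operators
are, up to weights, the transposed coefficient matrices; Schmidt number at most `r` therefore gives
Kraus operators of rank at most `r`. A vector of Schmidt rank at most `r` is the image under some `W
⊗ 1` of a vector in `ℂ^r ⊗ ℂ^d`, so an `r`-positive map behaves on such vectors, as inputs or as
test vectors, like a completely positive one. This yields both forward implications.

Conversely, `Λ = id` shows that `Φ` is completely positive. If its dual state lay outside the
compact convex hull of the pure states of Schmidt rank at most `r`, Hahn–Banach would give a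
separating functional `G`. The map `witnessMap G` is `r`-positive, and the operator trace of
`witnessMap G ∘ Φ` is `d * G (dualState Φ)`, whose real part is negative; but completely positive
maps have nonnegative operator trace. Since the trace is cyclic, one argument serves both orders of
composition. -/

open scoped Kronecker ComplexOrder Matrix

noncomputable section

/-! ### Compactness of convex hulls in finite dimension. -/

section ConvexHull

variable {E : Type*} [AddCommGroup E] [Module ℝ E] [FiniteDimensional ℝ E]

/-- In dimension `n`, a convex hull consists of the convex combinations of `n + 1` points. -/
theorem exists_stdSimplex_of_mem_convexHull {s : Set E} {x : E} (hx : x ∈ convexHull ℝ s) :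
    ∃ w ∈ stdSimplex ℝ (Fin (Module.finrank ℝ E + 1)),
      ∃ z ∈ Set.univ.pi fun _ : Fin (Module.finrank ℝ E + 1) => s, ∑ i, w i • z i = x := by
  obtain ⟨ι, hι, z, w, hz, hind, hw, hw1, hx⟩ := eq_pos_convex_span_of_mem_convexHull hx
  have hcard : Fintype.card ι ≤ Fintype.card (Fin (Module.finrank ℝ E + 1)) := by
    have h1 := hind.card_le_finrank_succ
    have h2 := (vectorSpan ℝ (Set.range z)).finrank_le
    simp only [Fintype.card_fin]
    lia
  obtain ⟨e⟩ := Function.Embedding.nonempty_of_card_le hcard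
  have hne : Nonempty ι := by
    by_contra h
    rw [not_nonempty_iff] at h
    simp at hw1
  obtain ⟨i₀⟩ := hne
  have hs : ∀ i, z i ∈ s := fun i => hz ⟨i, rfl⟩
  have hext : ∀ j, j ∉ Set.range e → Function.extend e w 0 j = 0 := fun j hj => by
    rw [Function.extend_apply' _ _ _ (by simpa using hj)]; rfl
  -- Unused slots get weight zero and the filler point `z i₀`, so that the number of points is
  -- fixed.
  refine ⟨Function.extend e w 0, ⟨fun j => ?_, ?_⟩, Function.extend e z fun _ => z i₀,
    fun j _ => ?_, ?_⟩
  · by_cases hj : ∃ i, e i = j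
    · obtain ⟨i, rfl⟩ := hj
      rw [e.injective.extend_apply]
      exact (hw i).le
    · rw [hext j hj]
  · rw [← hw1]
    refine (Fintype.sum_of_injective e e.injective _ _ hext fun i => ?_).symm
    rw [e.injective.extend_apply]
  · by_cases hj : ∃ i, e i = j
    · obtain ⟨i, rfl⟩ := hj
      rw [e.injective.extend_apply]
      exact hs i
    · rw [Function.extend_apply' _ _ _ hj]
      exact hs i₀
  · rw [← hx]
    refine (Fintype.sum_of_injective e e.injective _ _ (fun j hj => ?_) fun i => ?_).symm
    · rw [hext j hj, zero_smul]
    · rw [e.injective.extend_apply, e.injective.extend_apply]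

/-- By Carathéodory the hull is a continuous image of a simplex times a fixed finite power of `s`.
-/
theorem IsCompact.convexHull_of_finiteDimensional [TopologicalSpace E] [ContinuousAdd E]
    [ContinuousSMul ℝ E] {s : Set E} (hs : IsCompact s) : IsCompact (convexHull ℝ s) := by
  have himage : convexHull ℝ s =
      (fun q : (Fin (Module.finrank ℝ E + 1) → ℝ) × (Fin (Module.finrank ℝ E + 1) → E) =>
        ∑ i, q.1 i • q.2 i) '' (stdSimplex ℝ _ ×ˢ Set.univ.pi fun _ => s) := by
    refine Set.Subset.antisymm (fun x hx => ?_) ?_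
    · obtain ⟨w, hw, z, hz, h⟩ := exists_stdSimplex_of_mem_convexHull hx
      exact ⟨(w, z), ⟨hw, hz⟩, h⟩
    · rintro _ ⟨⟨w, z⟩, ⟨hw, hz⟩, rfl⟩
      exact mem_convexHull_of_exists_fintype w z hw.1 hw.2 (fun i => hz i trivial) rfl
  rw [himage]
  exact ((isCompact_stdSimplex ℝ _).prod (isCompact_univ_pi fun _ => hs)).image (by fun_prop)

end ConvexHull

/-! ### Matrix rank and positivity. -/

namespace Matrix

/-- Rank factorization, padded to an inner dimension `r` that is at least the rank. -/
theorem exists_eq_mul_of_rank_le {K m n : Type*} [Field K] [Fintype m] [Fintype n] {r : ℕ}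
    (M : Matrix m n K) (h : M.rank ≤ r) :
    ∃ (W : Matrix m (Fin r) K) (U : Matrix (Fin r) n K), M = W * U := by
  classical
  have h' : Module.finrank K (LinearMap.range M.mulVecLin) ≤ Module.finrank K (Fin r → K) := by
    rw [Module.finrank_fin_fun]
    exact h
  obtain ⟨g, hg⟩ := finrank_le_iff_exists_linearMap.mp h'
  obtain ⟨k, hk⟩ := g.exists_leftInverse_of_injective (LinearMap.ker_eq_bot.mpr hg)
  refine ⟨LinearMap.toMatrix' ((LinearMap.range M.mulVecLin).subtype ∘ₗ k),
    LinearMap.toMatrix' (g ∘ₗ M.mulVecLin.rangeRestrict), ?_⟩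
  rw [← LinearMap.toMatrix'_comp, LinearMap.comp_assoc, ← LinearMap.comp_assoc _ g, hk,
    LinearMap.id_comp]
  exact (LinearMap.toMatrix'_toLin' M).symm

/-- Rank is lower semicontinuous: having rank at least `r + 1` is an open condition. -/
theorem isClosed_setOf_rank_le {m n : Type*} [Fintype m] [Fintype n] (r : ℕ) :
    IsClosed {M : Matrix m n ℂ | M.rank ≤ r} := by
  classical
  let F : Matrix m n ℂ →ₗ[ℂ] ((n → ℂ) →L[ℂ] (m → ℂ)) :=
    LinearMap.toContinuousLinearMap.toLinearMap ∘ₗ (Matrix.toLin' (R := ℂ)).toLinearMap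
  have hF : Continuous F := F.continuous_of_finiteDimensional
  have hcompl : {M : Matrix m n ℂ | M.rank ≤ r}ᶜ =
      F ⁻¹' {f | ((r + 1 : ℕ) : Cardinal) ≤ (f : (n → ℂ) →ₗ[ℂ] (m → ℂ)).rank} := by
    ext M
    have hM : ((F M : (n → ℂ) →L[ℂ] (m → ℂ)) : (n → ℂ) →ₗ[ℂ] (m → ℂ)) = M.mulVecLin := rfl
    have hr : M.mulVecLin.rank = (M.rank : Cardinal) := by
      rw [LinearMap.rank, ← Module.finrank_eq_rank]; rfl
    simp [hM, hr]
  rw [← isOpen_compl_iff, hcompl]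
  exact (isOpen_setOfPred_nat_le_rank _).preimage hF

/-- Over the complex numbers a nonnegative quadratic form is automatically Hermitian. -/
theorem posSemidef_of_forall_dotProduct_mulVec_nonneg {n : Type*} [Fintype n] {M : Matrix n n ℂ}
    (h : ∀ x, 0 ≤ star x ⬝ᵥ (M *ᵥ x)) : M.PosSemidef := by
  classical
  rw [← Matrix.isPositive_toEuclideanLin_iff, LinearMap.isPositive_iff_complex]
  intro x
  have hx : inner ℂ (M.toEuclideanLin x) x = star (star x.ofLp ⬝ᵥ (M *ᵥ x.ofLp)) := by
    rw [EuclideanSpace.inner_eq_star_dotProduct, Matrix.star_dotProduct, star_star, dotProduct_comm]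
    rfl
  obtain ⟨hre, him⟩ := Complex.nonneg_iff.mp (h x.ofLp)
  rw [hx]
  exact ⟨Complex.ext rfl (by simp [← him]), by simpa using hre⟩

end Matrix

/-! ### Vectors as coefficient matrices, and `r`-positivity. -/

namespace SchmidtCPT

/-- The vector of `ℂ^k ⊗ ℂ^d` whose coordinates are the entries of a matrix. -/
def ket {k d : ℕ} (M : Matrix (Fin k) (Fin d) ℂ) : Fin k × Fin d → ℂ := fun p => M p.1 p.2

theorem ket_of {k d : ℕ} (v : Fin k × Fin d → ℂ) : ket (Matrix.of fun i j => v (i, j)) = v := rfl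

theorem kronecker_one_mulVec_ket {k l d : ℕ} (W : Matrix (Fin k) (Fin l) ℂ)
    (U : Matrix (Fin l) (Fin d) ℂ) : (W ⊗ₖ (1 : Mat d)) *ᵥ ket U = ket (W * U) := by
  ext ⟨s, a⟩
  simp [ket, Matrix.mulVec, dotProduct, Matrix.mul_apply, Fintype.sum_prod_type, Matrix.one_apply]

theorem one_kronecker_mulVec_ket {k d : ℕ} (B : Mat d) (U : Matrix (Fin k) (Fin d) ℂ) :
    ((1 : Mat k) ⊗ₖ B) *ᵥ ket U = ket (U * B.transpose) := by
  ext ⟨s, a⟩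
  simp [ket, Matrix.mulVec, dotProduct, Matrix.mul_apply, Fintype.sum_prod_type, Matrix.one_apply,
    Finset.sum_ite_eq, mul_comm]

theorem kronecker_one_conj_apply {k l d : ℕ} (W : Matrix (Fin k) (Fin l) ℂ) (X : BiMat l d)
    (s t : Fin k) (a b : Fin d) :
    ((W ⊗ₖ (1 : Mat d)) * X * (W ⊗ₖ (1 : Mat d)).conjTranspose) (s, a) (t, b) =
      ∑ i, ∑ j, W s i * star (W t j) * X (i, a) (j, b) := by
  rw [Finset.sum_comm]
  simp [Matrix.mul_apply, Fintype.sum_prod_type, Matrix.one_apply, Finset.sum_mul, apply_ite]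
  refine Finset.sum_congr rfl fun j _ => Finset.sum_congr rfl fun i _ => by ring

theorem one_kronecker_conj_apply {k d : ℕ} (B : Mat d) (X : BiMat k d)
    (s t : Fin k) (a b : Fin d) :
    (((1 : Mat k) ⊗ₖ B) * X * ((1 : Mat k) ⊗ₖ B).conjTranspose) (s, a) (t, b) =
      (B * (Matrix.of fun a b => X (s, a) (t, b)) * B.conjTranspose) a b := by
  simp [Matrix.mul_apply, Fintype.sum_prod_type, Matrix.one_apply, apply_ite]

/-- `id ⊗ Λ` commutes with conjugation by operators on the first factor. -/
theorem idTensor_kronecker_one_conj {k l d : ℕ} (Λ : Mat d →ₗ[ℂ] Mat d)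
    (W : Matrix (Fin k) (Fin l) ℂ) (X : BiMat l d) :
    idTensor k Λ ((W ⊗ₖ (1 : Mat d)) * X * (W ⊗ₖ (1 : Mat d)).conjTranspose) =
      (W ⊗ₖ (1 : Mat d)) * idTensor l Λ X * (W ⊗ₖ (1 : Mat d)).conjTranspose := by
  ext ⟨s, a⟩ ⟨t, b⟩
  rw [kronecker_one_conj_apply]
  have hblock : (Matrix.of fun a b =>
      ((W ⊗ₖ (1 : Mat d)) * X * (W ⊗ₖ (1 : Mat d)).conjTranspose) (s, a) (t, b) : Mat d) =
      ∑ i, ∑ j, (W s i * star (W t j)) • Matrix.of fun a b => X (i, a) (j, b) := by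
    ext a b
    simp [kronecker_one_conj_apply, Matrix.sum_apply]
  change Λ (Matrix.of fun a b => _) a b = _
  rw [hblock]
  simp only [map_sum, map_smul, Matrix.sum_apply, Matrix.smul_apply, smul_eq_mul]
  rfl

theorem idTensor_comp {k d : ℕ} (Λ Φ : Mat d →ₗ[ℂ] Mat d) (X : BiMat k d) :
    idTensor k (Λ ∘ₗ Φ) X = idTensor k Λ (idTensor k Φ X) := rfl

theorem conj_vecMulVec {m n : Type*} [Fintype m] [Fintype n] (A : Matrix m n ℂ) (v : n → ℂ) :
    A * Matrix.vecMulVec v (star v) * A.conjTranspose =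
      Matrix.vecMulVec (A *ᵥ v) (star (A *ᵥ v)) := by
  rw [Matrix.mul_vecMulVec, Matrix.vecMulVec_mul, Matrix.star_mulVec]

theorem dotProduct_conj_mulVec {m n : Type*} [Fintype m] [Fintype n] (A : Matrix m n ℂ)
    (Z : Matrix n n ℂ) (w : m → ℂ) :
    star w ⬝ᵥ ((A * Z * A.conjTranspose) *ᵥ w) =
      star (A.conjTranspose *ᵥ w) ⬝ᵥ (Z *ᵥ (A.conjTranspose *ᵥ w)) := by
  rw [Matrix.star_mulVec, Matrix.conjTranspose_conjTranspose, ← Matrix.dotProduct_mulVec,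
    Matrix.mulVec_mulVec, Matrix.mulVec_mulVec, Matrix.mul_assoc]

theorem schmidtRank_eq_rank {d : ℕ} (ψ : Fin d × Fin d → ℂ) :
    schmidtRank ψ = (Matrix.of fun i j => ψ (i, j) : Mat d).rank := by
  rw [schmidtRank, schmidtCoeff, LinearMap.card_support_singularValues,
    Matrix.rank_eq_finrank_range_toLin _ (EuclideanSpace.basisFun (Fin d) ℂ).toBasis
      (EuclideanSpace.basisFun (Fin d) ℂ).toBasis, Matrix.toEuclideanLin_eq_toLin_orthonormal]

/-- An `r`-positive map, tensored with any `id_k`, is positive on vectors of Schmidt rank at most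
`r`. -/
theorem IsKPositive.posSemidef_vecMulVec_ket {r k d : ℕ} {Λ : Mat d →ₗ[ℂ] Mat d}
    (hΛ : IsKPositive r Λ) (M : Matrix (Fin k) (Fin d) ℂ) (hM : M.rank ≤ r) :
    (idTensor k Λ (Matrix.vecMulVec (ket M) (star (ket M)))).PosSemidef := by
  obtain ⟨W, U, rfl⟩ := M.exists_eq_mul_of_rank_le hM
  rw [← kronecker_one_mulVec_ket, ← conj_vecMulVec, idTensor_kronecker_one_conj]
  exact (hΛ _ (Matrix.posSemidef_vecMulVec_self_star _)).mul_mul_conjTranspose_same _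

/-- Dual to the previous lemma: the factor `W` of the test vector is moved onto `X`, which is
thereby compressed to `M_r ⊗ M_d`, where `r`-positivity applies. -/
theorem IsKPositive.dotProduct_ket_nonneg {r k d : ℕ} {Λ : Mat d →ₗ[ℂ] Mat d}
    (hΛ : IsKPositive r Λ) {X : BiMat k d} (hX : X.PosSemidef) (M : Matrix (Fin k) (Fin d) ℂ)
    (hM : M.rank ≤ r) : 0 ≤ star (ket M) ⬝ᵥ (idTensor k Λ X *ᵥ ket M) := by
  obtain ⟨W, U, rfl⟩ := M.exists_eq_mul_of_rank_le hM
  have h := (hΛ _ (hX.mul_mul_conjTranspose_same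
    (W.conjTranspose ⊗ₖ (1 : Mat d)))).dotProduct_mulVec_nonneg (ket U)
  rwa [idTensor_kronecker_one_conj, dotProduct_conj_mulVec, Matrix.conjTranspose_kronecker,
    Matrix.conjTranspose_conjTranspose, Matrix.conjTranspose_one, kronecker_one_mulVec_ket] at h

/-! ### The dual state and Kraus decompositions. -/

theorem map_apply_eq_sum {d : ℕ} (Φ : Mat d →ₗ[ℂ] Mat d) (Y : Mat d) (a b : Fin d) :
    Φ Y a b = ∑ i, ∑ j, Y i j * Φ (Matrix.single i j 1) a b := by
  conv_lhs => rw [Matrix.matrix_eq_sum_single Y]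
  have h (i j : Fin d) : Matrix.single i j (Y i j) = Y i j • Matrix.single i j (1 : ℂ) := by simp
  simp only [h, map_sum, map_smul, Matrix.sum_apply, Matrix.smul_apply, smul_eq_mul]

theorem maxEntangled_eq (d : ℕ) :
    maxEntangled d = ((Real.sqrt d)⁻¹ : ℂ) • ket (1 : Mat d) := by
  rw [maxEntangled]
  congr 1
  ext ⟨i, j⟩
  simp [ket, Matrix.one_apply, Pi.single_apply, Prod.ext_iff, ite_and, eq_comm]

theorem ketBra_maxEntangled (d : ℕ) :
    ketBra (maxEntangled d) = (d : ℂ)⁻¹ • ketBra (ket (1 : Mat d)) := by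
  have h : ((Real.sqrt d : ℂ))⁻¹ * ((Real.sqrt d : ℂ))⁻¹ = (d : ℂ)⁻¹ := by
    rw [← mul_inv, ← Complex.ofReal_mul, Real.mul_self_sqrt d.cast_nonneg, Complex.ofReal_natCast]
  have hs : star ((Real.sqrt d : ℂ))⁻¹ = ((Real.sqrt d : ℂ))⁻¹ := by simp
  rw [maxEntangled_eq, ketBra, ketBra, star_smul, Matrix.vecMulVec_smul, Matrix.smul_vecMulVec,
    smul_smul, hs, h]

theorem idTensor_ketBra_ket_one_apply {d : ℕ} (Φ : Mat d →ₗ[ℂ] Mat d) (i a j b : Fin d) :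
    idTensor d Φ (ketBra (ket 1)) (i, a) (j, b) = Φ (Matrix.single i j 1) a b := by
  have h : (Matrix.of fun a b => ketBra (ket (1 : Mat d)) (i, a) (j, b) : Mat d) =
      Matrix.single i j 1 := by
    ext a b
    simp [ketBra, Matrix.vecMulVec_apply, ket, Matrix.one_apply, Matrix.single_apply, ← ite_and,
      and_comm]
  rw [← h]
  rfl

theorem dualState_apply {d : ℕ} (Φ : Mat d →ₗ[ℂ] Mat d) (i a j b : Fin d) :
    dualState Φ (i, a) (j, b) = (d : ℂ)⁻¹ * Φ (Matrix.single i j 1) a b := by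
  rw [dualState, ketBra_maxEntangled, map_smul, Matrix.smul_apply, smul_eq_mul,
    idTensor_ketBra_ket_one_apply]

/-- A decomposition of the dual state into pure states yields a Kraus decomposition of the map. -/
theorem idTensor_eq_sum_of_dualState_eq {k d m : ℕ} (hd : d ≠ 0) {Φ : Mat d →ₗ[ℂ] Mat d}
    {p : Fin m → ℝ} {ψ : Fin m → Fin d × Fin d → ℂ}
    (h : dualState Φ = ∑ l, (p l : ℂ) • ketBra (ψ l)) (Y : BiMat k d) :
    idTensor k Φ Y = ∑ l, ((d * p l : ℝ) : ℂ) •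
      (((1 : Mat k) ⊗ₖ (Matrix.of fun i j => ψ l (i, j) : Mat d)ᵀ) * Y *
        ((1 : Mat k) ⊗ₖ (Matrix.of fun i j => ψ l (i, j) : Mat d)ᵀ)ᴴ) := by
  have hd' : (d : ℂ) ≠ 0 := by exact_mod_cast hd
  -- The entries of the dual state are the values of `Φ` on matrix units; the factor `d` undoes the
  -- normalization of `P⁺`.
  have hsingle (i j a b : Fin d) : Φ (Matrix.single i j 1) a b =
      ∑ l, (d : ℂ) * p l * (ψ l (i, a) * star (ψ l (j, b))) := by
    have h1 := congrFun (congrFun h (i, a)) (j, b)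
    rw [dualState_apply, inv_mul_eq_iff_eq_mul₀ hd'] at h1
    rw [h1, Matrix.sum_apply, Finset.mul_sum]
    refine Finset.sum_congr rfl fun l _ => ?_
    simp [ketBra, Matrix.vecMulVec_apply, mul_assoc]
  ext ⟨s, a⟩ ⟨t, b⟩
  change Φ (Matrix.of fun a b => Y (s, a) (t, b)) a b = _
  rw [map_apply_eq_sum, Matrix.sum_apply]
  simp only [Matrix.smul_apply, one_kronecker_conj_apply, hsingle]
  simp only [Finset.mul_sum]
  refine ((Finset.sum_congr rfl fun i _ => Finset.sum_comm).trans Finset.sum_comm).trans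
    (Finset.sum_congr rfl fun l _ => ?_)
  simp only [Matrix.mul_apply, Matrix.transpose_apply, Matrix.conjTranspose_apply, Matrix.of_apply,
    Finset.mul_sum, Finset.sum_mul, smul_eq_mul]
  rw [Finset.sum_comm]
  refine Finset.sum_congr rfl fun j _ => Finset.sum_congr rfl fun i _ => ?_
  push_cast
  ring

theorem exists_isPureDecomposition {d r : ℕ} {σ : BiMat d d} (h : schmidtNumber σ ≤ r) :
    ∃ (m : ℕ) (p : Fin m → ℝ) (ψ : Fin m → Fin d × Fin d → ℂ),
      IsPureDecomposition σ p ψ ∧ ∀ l, schmidtRank (ψ l) ≤ r := by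
  -- With no decomposition the infimum would be `⊤`, which exceeds `r`; a nonempty subset of `ℕ∞`
  -- attains its infimum.
  have hne : {n : ℕ∞ | ∃ (m : ℕ) (p : Fin m → ℝ) (ψ : Fin m → Fin d × Fin d → ℂ),
      IsPureDecomposition σ p ψ ∧
        n = ((Finset.univ.sup fun k => schmidtRank (ψ k) : ℕ) : ℕ∞)}.Nonempty := by
    by_contra hne
    rw [Set.not_nonempty_iff_eq_empty] at hne
    rw [schmidtNumber, hne, sInf_empty] at h
    simp at h
  obtain ⟨m, p, ψ, hdec, hsup⟩ := csInf_mem hne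
  rw [schmidtNumber, hsup, Nat.cast_le] at h
  exact ⟨m, p, ψ, hdec, fun l => (Finset.le_sup (f := fun k => schmidtRank (ψ k))
    (Finset.mem_univ l)).trans h⟩

theorem schmidtNumber_le {d r m : ℕ} {σ : BiMat d d} {p : Fin m → ℝ}
    {ψ : Fin m → Fin d × Fin d → ℂ} (h : IsPureDecomposition σ p ψ)
    (hr : ∀ l, schmidtRank (ψ l) ≤ r) : schmidtNumber σ ≤ r :=
  csInf_le_of_le (OrderBot.bddBelow _) ⟨m, p, ψ, h, rfl⟩
    (Nat.cast_le.mpr (Finset.sup_le fun l _ => hr l))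

/-- Kraus operators of rank at most `r` send every vector to one of Schmidt rank at most `r`. -/
theorem isCP_comp_left_of_schmidtNumber_le {d r : ℕ} (hd : d ≠ 0) {Φ Λ : Mat d →ₗ[ℂ] Mat d}
    (hΦ : mapSchmidtNumber Φ ≤ r) (hΛ : IsKPositive r Λ) : IsCP (Λ ∘ₗ Φ) := by
  obtain ⟨m, p, ψ, hdec, hrank⟩ := exists_isPureDecomposition hΦ
  intro k X hX
  obtain ⟨n, v, rfl⟩ := Matrix.posSemidef_iff_eq_sum_vecMulVec.mp hX
  rw [map_sum]
  refine Matrix.posSemidef_sum _ fun q _ => ?_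
  rw [idTensor_comp, idTensor_eq_sum_of_dualState_eq hd hdec.eq_sum, map_sum]
  refine Matrix.posSemidef_sum _ fun l _ => ?_
  rw [map_smul, conj_vecMulVec, ← ket_of (v q), one_kronecker_mulVec_ket,
    Matrix.transpose_transpose]
  refine Matrix.PosSemidef.smul (hΛ.posSemidef_vecMulVec_ket _ ?_)
    (Complex.zero_le_real.mpr (mul_nonneg d.cast_nonneg (hdec.nonneg l)))
  exact (Matrix.rank_mul_le_right _ _).trans ((schmidtRank_eq_rank _).symm.trans_le (hrank l))

/-- Here the adjoint Kraus operators act on the test vector and lower its Schmidt rank, while `X`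
stays arbitrary. -/
theorem isCP_comp_right_of_schmidtNumber_le {d r : ℕ} (hd : d ≠ 0) {Φ Λ : Mat d →ₗ[ℂ] Mat d}
    (hΦ : mapSchmidtNumber Φ ≤ r) (hΛ : IsKPositive r Λ) : IsCP (Φ ∘ₗ Λ) := by
  obtain ⟨m, p, ψ, hdec, hrank⟩ := exists_isPureDecomposition hΦ
  intro k X hX
  rw [idTensor_comp, idTensor_eq_sum_of_dualState_eq hd hdec.eq_sum]
  refine Matrix.posSemidef_sum _ fun l _ => Matrix.PosSemidef.smul ?_
    (Complex.zero_le_real.mpr (mul_nonneg d.cast_nonneg (hdec.nonneg l)))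
  refine Matrix.posSemidef_of_forall_dotProduct_mulVec_nonneg fun w => ?_
  rw [dotProduct_conj_mulVec, Matrix.conjTranspose_kronecker, Matrix.conjTranspose_one,
    ← ket_of w, one_kronecker_mulVec_ket]
  refine hΛ.dotProduct_ket_nonneg hX _ ((Matrix.rank_mul_le_right _ _).trans ?_)
  rw [Matrix.rank_transpose, Matrix.rank_conjTranspose, Matrix.rank_transpose]
  exact (schmidtRank_eq_rank _).symm.trans_le (hrank l)

/-! ### The operator trace of a map. -/

/-- The trace of `Λ ∘ Φ` as a linear operator on matrices. -/
theorem sum_comp_single {d : ℕ} (Λ Φ : Mat d →ₗ[ℂ] Mat d) :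
    ∑ i, ∑ j, (Λ ∘ₗ Φ) (Matrix.single i j 1) i j = ∑ i, ∑ j, ∑ a, ∑ b,
      Φ (Matrix.single i j 1) a b * Λ (Matrix.single a b 1) i j :=
  Finset.sum_congr rfl fun i _ => Finset.sum_congr rfl fun j _ =>
    map_apply_eq_sum Λ (Φ (Matrix.single i j 1)) i j

theorem sum_comp_single_comm {d : ℕ} (Λ Φ : Mat d →ₗ[ℂ] Mat d) :
    ∑ i, ∑ j, (Λ ∘ₗ Φ) (Matrix.single i j 1) i j =
      ∑ i, ∑ j, (Φ ∘ₗ Λ) (Matrix.single i j 1) i j := by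
  have h := Finset.sum_comm (s := (Finset.univ : Finset (Fin d × Fin d)))
    (t := (Finset.univ : Finset (Fin d × Fin d)))
    (f := fun x y => Φ (Matrix.single x.1 x.2 1) y.1 y.2 * Λ (Matrix.single y.1 y.2 1) x.1 x.2)
  simp only [Fintype.sum_prod_type] at h
  rw [sum_comp_single, sum_comp_single, h]
  simp only [mul_comm]

/-- The sum is the expectation of `(id ⊗ Θ)(|Ω⟩⟨Ω|)` in `Ω = ∑ e_i ⊗ e_i`. -/
theorem IsCP.sum_single_nonneg {d : ℕ} {Θ : Mat d →ₗ[ℂ] Mat d} (h : IsCP Θ) :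
    0 ≤ ∑ i, ∑ j, Θ (Matrix.single i j 1) i j := by
  have h1 := (h d _ (Matrix.posSemidef_vecMulVec_self_star (ket 1))).dotProduct_mulVec_nonneg
    (ket 1)
  convert h1 using 1
  simp only [dotProduct, Matrix.mulVec, Fintype.sum_prod_type, Pi.star_apply]
  have h2 (i a j b : Fin d) := idTensor_ketBra_ket_one_apply Θ i a j b
  rw [ketBra] at h2
  simp [h2, ket, Matrix.one_apply, apply_ite, Finset.sum_ite_eq, ite_mul]

theorem isKPositive_id (k d : ℕ) : IsKPositive k (LinearMap.id : Mat d →ₗ[ℂ] Mat d) :=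
  fun _ hX => hX

/-! ### From functionals to `r`-positive maps. -/

/-- The map `Y ↦ ∑_ab Y_ab G(E_(i,a),(j,b))` associated to a functional on bipartite operators. -/
def witnessMap {d : ℕ} (G : BiMat d d →ₗ[ℂ] ℂ) : Mat d →ₗ[ℂ] Mat d where
  toFun Y := Matrix.of fun i j => ∑ a, ∑ b, Y a b * G (Matrix.single (i, a) (j, b) 1)
  map_add' X Y := by
    ext i j
    simp [add_mul, Finset.sum_add_distrib]
  map_smul' c X := by
    ext i j
    simp [mul_assoc, Finset.mul_sum]

theorem witnessMap_apply {d : ℕ} (G : BiMat d d →ₗ[ℂ] ℂ) (Y : Mat d) (i j : Fin d) :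
    witnessMap G Y i j = ∑ a, ∑ b, Y a b * G (Matrix.single (i, a) (j, b) 1) := rfl

theorem functional_apply_eq_sum {d : ℕ} (G : BiMat d d →ₗ[ℂ] ℂ) (X : BiMat d d) :
    G X = ∑ i, ∑ a, ∑ j, ∑ b, X (i, a) (j, b) * G (Matrix.single (i, a) (j, b) 1) := by
  conv_lhs => rw [Matrix.matrix_eq_sum_single X]
  have h (p q : Fin d × Fin d) : Matrix.single p q (X p q) = X p q • Matrix.single p q (1 : ℂ) := by
    simp
  simp only [h, map_sum, map_smul, smul_eq_mul, Fintype.sum_prod_type]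

theorem sum_witnessMap_comp_single {d : ℕ} (hd : d ≠ 0) (G : BiMat d d →ₗ[ℂ] ℂ)
    (Φ : Mat d →ₗ[ℂ] Mat d) :
    ∑ i, ∑ j, (witnessMap G ∘ₗ Φ) (Matrix.single i j 1) i j = d * G (dualState Φ) := by
  have hd' : (d : ℂ) ≠ 0 := by exact_mod_cast hd
  simp only [LinearMap.comp_apply, witnessMap_apply]
  rw [functional_apply_eq_sum, Finset.mul_sum]
  refine Finset.sum_congr rfl fun i _ => ?_
  simp only [dualState_apply, Finset.mul_sum]
  rw [Finset.sum_comm (s := Finset.univ (α := Fin d)) (t := Finset.univ)]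
  refine Finset.sum_congr rfl fun j _ => Finset.sum_congr rfl fun a _ =>
    Finset.sum_congr rfl fun b _ => ?_
  field_simp

theorem isKPositive_witnessMap {d r : ℕ} {G : BiMat d d →ₗ[ℂ] ℂ}
    (hG : ∀ M : Mat d, M.rank ≤ r → 0 ≤ G (ketBra (ket M))) : IsKPositive r (witnessMap G) := by
  intro X hX
  obtain ⟨n, v, rfl⟩ := Matrix.posSemidef_iff_eq_sum_vecMulVec.mp hX
  rw [map_sum]
  refine Matrix.posSemidef_sum _ fun q _ => ?_
  refine Matrix.posSemidef_of_forall_dotProduct_mulVec_nonneg fun w => ?_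
  let V : Matrix (Fin r) (Fin d) ℂ := Matrix.of fun s a => v q (s, a)
  let N : Matrix (Fin r) (Fin d) ℂ := Matrix.of fun s a => w (s, a)
  -- The quadratic form of a rank-one input `v` at `w` is `G` on the vector with matrix `Nᴴ * V`,
  -- whose rank is at most the inner dimension `r`.
  convert hG (Nᴴ * V) (((Matrix.rank_mul_le_right _ _).trans (Matrix.rank_le_height _))) using 1
  rw [functional_apply_eq_sum]
  have hblock (s t : Fin r) (i j : Fin d) : idTensor r (witnessMap G)
      (Matrix.vecMulVec (v q) (star (v q))) (s, i) (t, j) =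
      ∑ a, ∑ b, V s a * star (V t b) * G (Matrix.single (i, a) (j, b) 1) := rfl
  simp only [dotProduct, Matrix.mulVec, Fintype.sum_prod_type, Pi.star_apply, hblock, ketBra,
    Matrix.vecMulVec_apply, ket, Matrix.mul_apply, Matrix.conjTranspose_apply]
  simp only [star_sum, Finset.mul_sum, Finset.sum_mul]
  -- All six sums are reordered at once by a bijection of index tuples.
  have hsum (F : Fin r → Fin d → Fin r → Fin d → Fin d → Fin d → ℂ) :
      ∑ s, ∑ i, ∑ t, ∑ j, ∑ a, ∑ b, F s i t j a b =
        ∑ i, ∑ a, ∑ j, ∑ b, ∑ t, ∑ s, F s i t j a b := by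
    have h := Fintype.sum_equiv
      (⟨fun x => (x.2.1, x.2.2.2.2.1, x.2.2.2.1, x.2.2.2.2.2, x.2.2.1, x.1),
        fun y => (y.2.2.2.2.2, y.1, y.2.2.2.2.1, y.2.2.1, y.2.1, y.2.2.2.1),
        fun _ => rfl, fun _ => rfl⟩ :
        (Fin r × Fin d × Fin r × Fin d × Fin d × Fin d) ≃
          (Fin d × Fin d × Fin d × Fin d × Fin r × Fin r))
      (fun x => F x.1 x.2.1 x.2.2.1 x.2.2.2.1 x.2.2.2.2.1 x.2.2.2.2.2)
      (fun y => F y.2.2.2.2.2 y.1 y.2.2.2.2.1 y.2.2.1 y.2.1 y.2.2.2.1) (fun _ => rfl)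
    simpa only [Fintype.sum_prod_type] using h
  rw [hsum]
  refine Finset.sum_congr rfl fun i _ => Finset.sum_congr rfl fun a _ =>
    Finset.sum_congr rfl fun j _ => Finset.sum_congr rfl fun b _ =>
    Finset.sum_congr rfl fun t _ => Finset.sum_congr rfl fun s _ => ?_
  simp only [N, V, Matrix.of_apply, star_mul', star_star]
  ring

/-! ### Pure states of bounded Schmidt rank and their separation. -/

/-- The projectors on unit vectors of Schmidt rank at most `r`. -/
def pureStates (d r : ℕ) : Set (BiMat d d) :=
  (fun M : Mat d => ketBra (ket M)) ''
    ({M : Mat d | M.rank ≤ r} ∩ {M : Mat d | ∑ x, ‖ket M x‖ ^ 2 = 1})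

theorem isCompact_pureStates (d r : ℕ) : IsCompact (pureStates d r) := by
  have hket (x : Fin d × Fin d) : Continuous fun M : Mat d => ket M x :=
    continuous_id.matrix_elem x.1 x.2
  refine IsCompact.image ?_ ?_
  · have hclosed : IsClosed ({M : Mat d | M.rank ≤ r} ∩ {M : Mat d | ∑ x, ‖ket M x‖ ^ 2 = 1}) :=
      (Matrix.isClosed_setOf_rank_le r).inter (isClosed_eq
        (continuous_finsetSum _ fun x _ => (hket x).norm.pow 2) continuous_const)
    have hcompact : IsCompact (Set.univ.pi fun _ : Fin d => Set.univ.pi fun _ : Fin d =>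
        Metric.closedBall (0 : ℂ) 1) :=
      isCompact_univ_pi fun _ => isCompact_univ_pi fun _ => isCompact_closedBall _ _
    refine IsCompact.of_isClosed_subset (X := Mat d) hcompact hclosed fun M hM i _ j _ => ?_
    have h1 : ‖ket M (i, j)‖ ^ 2 ≤ 1 := by
      rw [← show ∑ x, ‖ket M x‖ ^ 2 = 1 from hM.2]
      exact Finset.single_le_sum (f := fun x => ‖ket M x‖ ^ 2) (fun x _ => sq_nonneg _)
        (Finset.mem_univ _)
    rw [mem_closedBall_zero_iff]
    exact (sq_le_one_iff₀ (norm_nonneg _)).mp h1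
  · refine continuous_matrix fun x y => ?_
    simp only [ketBra, Matrix.vecMulVec_apply, Pi.star_apply]
    exact (hket x).mul (hket y).star

theorem trace_ketBra {d : ℕ} (ψ : Fin d × Fin d → ℂ) :
    (ketBra ψ).trace = ((∑ x, ‖ψ x‖ ^ 2 : ℝ) : ℂ) := by
  rw [ketBra, Matrix.trace_vecMulVec]
  push_cast
  exact Finset.sum_congr rfl fun x _ => Complex.mul_conj' _

theorem isHermitian_ketBra {d : ℕ} (ψ : Fin d × Fin d → ℂ) : (ketBra ψ).IsHermitian :=
  (Matrix.posSemidef_vecMulVec_self_star ψ).isHermitian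

theorem schmidtNumber_le_of_mem_convexHull {d r : ℕ} {σ : BiMat d d}
    (h : σ ∈ convexHull ℝ (pureStates d r)) : schmidtNumber σ ≤ r := by
  obtain ⟨ι, hι, w, z, hw, hw1, hz, rfl⟩ := mem_convexHull_iff_exists_fintype.mp h
  choose M hM hMz using hz
  let e := Fintype.equivFin ι
  refine schmidtNumber_le (p := w ∘ e.symm) (ψ := fun l => ket (M (e.symm l)))
    ⟨fun l => hw _, ?_, fun l => (hM _).2, ?_⟩ fun l => ?_
  · rw [← hw1]
    exact e.symm.sum_comp w
  · rw [← e.symm.sum_comp]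
    refine Finset.sum_congr rfl fun l _ => ?_
    rw [← hMz, Complex.coe_smul]
    rfl
  · rw [schmidtRank_eq_rank]
    exact (hM _).1

/-- A Schmidt number witness: a functional, nonnegative on vectors of Schmidt rank at most `r`,
that is negative on a given state outside their convex hull. -/
theorem exists_witness {d r : ℕ} {σ : BiMat d d} (hσ : σ.IsHermitian) (htr : σ.trace = 1)
    (h : σ ∉ convexHull ℝ (pureStates d r)) :
    ∃ G : BiMat d d →ₗ[ℂ] ℂ, (∀ M : Mat d, M.rank ≤ r → 0 ≤ G (ketBra (ket M))) ∧
      (G σ).re < 0 := by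
  have : LocallyConvexSpace ℝ (BiMat d d) :=
    inferInstanceAs (LocallyConvexSpace ℝ (Fin d × Fin d → Fin d × Fin d → ℂ))
  obtain ⟨f, u, hfσ, hf⟩ := RCLike.geometric_hahn_banach_point_closed (𝕜 := ℂ)
    (convex_convexHull ℝ (pureStates d r))
    (isCompact_pureStates d r).convexHull_of_finiteDimensional.isClosed h
  -- Symmetrizing makes `G` real on Hermitian matrices while keeping it complex linear; subtracting
  -- `u * trace` moves the separating threshold to zero on trace-one matrices.
  let G : BiMat d d →ₗ[ℂ] ℂ :=
    { toFun := fun X => (f X + star (f Xᴴ)) / 2 - u * X.trace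
      map_add' := fun X Y => by
        simp only [Matrix.conjTranspose_add, map_add, star_add, Matrix.trace_add]
        ring
      map_smul' := fun c X => by
        simp only [Matrix.conjTranspose_smul, map_smul, smul_eq_mul, star_mul', star_star,
          Matrix.trace_smul, RingHom.id_apply]
        ring }
  have hG (X : BiMat d d) (hX : X.IsHermitian) : G X = ((f X).re : ℂ) - u * X.trace := by
    change (f X + star (f Xᴴ)) / 2 - u * X.trace = _
    rw [hX.eq, ← starRingEnd_apply, Complex.add_conj]
    simp
  refine ⟨G, fun M hM => ?_, ?_⟩
  · have hn : 0 ≤ ∑ x, ‖ket M x‖ ^ 2 := Finset.sum_nonneg fun x _ => sq_nonneg _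
    rcases hn.eq_or_lt with h0 | hpos
    · have hzero : ket M = 0 := by
        funext x
        have := (Finset.sum_eq_zero_iff_of_nonneg fun x _ => sq_nonneg ‖ket M x‖).mp h0.symm x
          (Finset.mem_univ x)
        simpa using this
      have : ketBra (ket M) = 0 := by rw [hzero, ketBra, Matrix.zero_vecMulVec]
      rw [this, map_zero]
    · set n := ∑ x, ‖ket M x‖ ^ 2 with hn_def
      -- Separation is known only for unit vectors, so `M` is normalized; positivity scales back.
      let c : ℂ := ((Real.sqrt n)⁻¹ : ℝ)
      have hcc : c * star c = ((n⁻¹ : ℝ) : ℂ) := by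
        simp only [c, Complex.star_def, Complex.conj_ofReal]
        rw [← Complex.ofReal_mul, ← mul_inv, Real.mul_self_sqrt hn]
      have hket : ket (c • M) = c • ket M := rfl
      have hmem : ketBra (ket (c • M)) ∈ pureStates d r := by
        refine ⟨c • M, ⟨?_, ?_⟩, rfl⟩
        · refine le_trans ?_ hM
          rw [Matrix.smul_eq_diagonal_mul]
          exact Matrix.rank_mul_le_right _ _
        · simp only [Set.mem_ofPred_eq, hket, Pi.smul_apply, smul_eq_mul, norm_mul, mul_pow,
            ← Finset.mul_sum, ← hn_def]
          simp [c, inv_pow, Real.sq_sqrt hn, hpos.ne']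
      have hscale : ketBra (ket (c • M)) = ((n⁻¹ : ℝ) : ℂ) • ketBra (ket M) := by
        rw [hket, ketBra, ketBra, star_smul, Matrix.vecMulVec_smul, Matrix.smul_vecMulVec,
          smul_smul, mul_comm, hcc]
      have hlt := hf _ (subset_convexHull ℝ _ hmem)
      rw [hscale, map_smul, smul_eq_mul, RCLike.re_to_complex, Complex.re_ofReal_mul] at hlt
      rw [hG _ (isHermitian_ketBra _), trace_ketBra, ← hn_def, ← Complex.ofReal_mul,
        ← Complex.ofReal_sub, Complex.zero_le_real, sub_nonneg]
      have := mul_lt_mul_of_pos_right hlt hpos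
      field_simp at this
      exact this.le
  · rw [hG σ hσ, htr, mul_one, ← Complex.ofReal_sub, Complex.ofReal_re]
    exact sub_neg.mpr hfσ

/-! ### The converse implications. -/

theorem trace_dualState {d : ℕ} (hd : d ≠ 0) {Φ : Mat d →ₗ[ℂ] Mat d} (hΦ : IsTP Φ) :
    (dualState Φ).trace = 1 := by
  have h (i : Fin d) : ∑ a, Φ (Matrix.single i i 1) a a = 1 :=
    (hΦ _).trans (Matrix.trace_single_eq_same i 1)
  simp only [Matrix.trace, Matrix.diag, Fintype.sum_prod_type, dualState_apply, ← Finset.mul_sum, h]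
  simp [hd]

theorem isRCPT_of_forall {d r : ℕ} (hd : d ≠ 0) {Φ : Mat d →ₗ[ℂ] Mat d} (hTP : IsTP Φ)
    (hCP : IsCP Φ)
    (h : ∀ Λ : Mat d →ₗ[ℂ] Mat d, IsKPositive r Λ →
      0 ≤ ∑ i, ∑ j, (Λ ∘ₗ Φ) (Matrix.single i j 1) i j) : IsRCPT r Φ := by
  refine ⟨⟨hCP, hTP⟩, schmidtNumber_le_of_mem_convexHull ?_⟩
  by_contra hmem
  obtain ⟨G, hG, hneg⟩ := exists_witness
    (hCP d _ (Matrix.posSemidef_vecMulVec_self_star (maxEntangled d))).isHermitian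
    (trace_dualState hd hTP) hmem
  have h1 := h _ (isKPositive_witnessMap hG)
  rw [sum_witnessMap_comp_single hd] at h1
  have h2 := (Complex.nonneg_iff.mp h1).1
  rw [← Complex.ofReal_natCast, Complex.re_ofReal_mul] at h2
  exact absurd (nonneg_of_mul_nonneg_right h2 (by positivity)) hneg.not_ge

end SchmidtCPT

end

theorem theorem2 (d r : ℕ) (hd : 1 ≤ d) (hr : 1 ≤ r)
    (Φ : SchmidtCPT.Mat d →ₗ[ℂ] SchmidtCPT.Mat d) :
    (SchmidtCPT.IsRCPT r Φ ↔
      SchmidtCPT.IsTP Φ ∧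
        ∀ Λ : SchmidtCPT.Mat d →ₗ[ℂ] SchmidtCPT.Mat d,
          SchmidtCPT.IsKPositive r Λ → SchmidtCPT.IsCP (Λ ∘ₗ Φ)) ∧
    (SchmidtCPT.IsRCPT r Φ ↔
      SchmidtCPT.IsTP Φ ∧
        ∀ Λ : SchmidtCPT.Mat d →ₗ[ℂ] SchmidtCPT.Mat d,
          SchmidtCPT.IsKPositive r Λ → SchmidtCPT.IsCP (Φ ∘ₗ Λ)) := by
  have hd' : d ≠ 0 := Nat.one_le_iff_ne_zero.mp hd
  refine ⟨⟨fun h => ⟨h.1.2, fun Λ hΛ => ?_⟩, fun h => ?_⟩,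
    ⟨fun h => ⟨h.1.2, fun Λ hΛ => ?_⟩, fun h => ?_⟩⟩
  · exact SchmidtCPT.isCP_comp_left_of_schmidtNumber_le hd' h.2 hΛ
  -- The identity is `r`-positive, so the hypothesis already contains complete positivity of `Φ`.
  · exact SchmidtCPT.isRCPT_of_forall hd' h.1 (h.2 _ (SchmidtCPT.isKPositive_id r d))
      fun Λ hΛ => (h.2 Λ hΛ).sum_single_nonneg
  · exact SchmidtCPT.isCP_comp_right_of_schmidtNumber_le hd' h.2 hΛ
  · refine SchmidtCPT.isRCPT_of_forall hd' h.1 (h.2 _ (SchmidtCPT.isKPositive_id r d))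
      fun Λ hΛ => ?_
    rw [SchmidtCPT.sum_comp_single_comm]
    exact (h.2 Λ hΛ).sum_single_nonneg
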